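/- **Setting.** Let $\Lambda\ge 0$ be a random variable with distribution function $F_\Lambda$ and tail $\overline F_\Lambda=1-F_\Lambda$. A random variable $X$ has the mixed Poisson distribution $\mathrm{MP}(F_\Lambda)$ if $X\mid(\Lambda=\lambda)\sim\mathrm{Poisson}(\lambda)$. In the Gerber--Dickson risk model with integer initial capital $u\ge 0$ and i.i.d. claims $Y_1,Y_2,\dots$ with values in $\{0,1,2,\dots\}$, the risk process is $U(t)=u+t-\sum_{i=1}^t Y_i$, $t=0,1,2,\dots$. The time of ruin is $\tau=\min\{t\ge 1: U(t)\le 0\}$ (with $\tau=\infty$ if there is no such $t$), and the ruin probability is $\psi(u)=P(\tau<\infty\mid U(0)=u)$. For $0<p<1$ and an integer $k\ge 1$ let $\mathrm{nb}(k,p)(x)=\binom{k+x-1}{x}p^k(1-p)^x$, $x=0,1,2,\dots$, be the probability function of $\mathrm{NegBin}(k,p)$, and let $\mathrm{NegBin}(0,p)$ be the unit mass at $0$. Assume that the claims have an $\mathrm{MP}(F_\Lambda)$ distribution with mean $\mu$ satisfying $0<\mu<1$. For each $n\ge 1$ let $X_n$ have the negative binomial mixture distribution $$P(X_n=x)=\sum_{k=0}^\infty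 q(k,n)\,\mathrm{nb}\!\left(k,\tfrac{n}{n+1}\right)(x),\qquad q(k,n)=F_\Lambda\!\left(\tfrac kn\right)-F_\Lambda\!\left(\tfrac{k-1}n\right),$$ where $q(0,n)=P(\Lambda=0)$, so that the term $k=0$ is absent when $\Lambda>0$ almost surely. Let $\psi_n(u)$ be the ruin probability in the Gerber--Dickson model with claims distributed as $X_n$. **Theorem.** For every integer $u\ge 0$, $$\psi(u)=\lim_{n\to\infty}\psi_n(u).$$ Moreover $\sum_{j\ge0}\overline F_\Lambda(j/n)<\infty$ for every $n\ge 1$, $E(X_n)<1$ for all sufficiently large $n$, and for every $n\ge 1$ with $E(X_n)<1$ and every integer $u\ge0$, $$\psi_n(u)=\sum_{k=0}^\infty \overline C_{k,n}\,P(Z=k)=E\big(\overline C_{Z,n}\big),\qquad Z\sim\mathrm{NegBin}\!\left(u,\tfrac1{1+n}\right),$$ where the series converges absolutely and the coefficients are given by $$\overline C_{0,n}=\frac1n\sum_{j=0}^\infty \overline F_\Lambda(j/n),\qquad \overline C_{k,n}=\overline C_{0,n}\Big[\sum_{i=1}^k f_{Ne}(i)\,\overline C_{k-i,n}+\overline F_{Ne}(k)\Big],\quad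 k\ge 1,$$ $$f_{Ne}(i)=\frac{\overline F_\Lambda((i-1)/n)}{\sum_{j=0}^\infty\overline F_\Lambda(j/n)},\quad i\ge1,\qquad \overline F_{Ne}(k)=1-\sum_{i=1}^k f_{Ne}(i).$$ Consequently $\psi(u)=\lim_{n\to\infty}\sum_{k=0}^\infty \overline C_{k,n}\,P(Z=k)$ for every integer $u\ge 0$. -/

import Mathlib

open MeasureTheory ProbabilityTheory Filter Topology
open scoped NNReal ENNReal

noncomputable section

/-! ### The discrete time risk process of Gerber and Dickson -/

/-- `Y 0, Y 1, …` (the claims `Y_1, Y_2, …` of the model) are independent random variables on the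
probability space `(Ω, P)`, all with distribution `μ` on `{0, 1, 2, …}`. -/
structure IsClaimSequence {Ω : Type*} [MeasurableSpace Ω] (P : Measure Ω) (Y : ℕ → Ω → ℕ)
    (μ : Measure ℕ) : Prop where
  isProbabilityMeasure : IsProbabilityMeasure P
  measurable : ∀ i, Measurable (Y i)
  law : ∀ i, P.map (Y i) = μ
  indep : iIndepFun Y P

/-- The risk process `U(t) = u + t - (Y_1 + ⋯ + Y_t)` with initial capital `u`. -/
def riskProcess {Ω : Type*} (Y : ℕ → Ω → ℕ) (u : ℕ) (t : ℕ) (ω : Ω) : ℤ :=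
  (u : ℤ) + t - ∑ i ∈ Finset.range t, (Y i ω : ℤ)

/-- The time of ruin `τ = min {t ≥ 1 : U(t) ≤ 0}`, with `τ = ∞` if there is no such `t`. -/
def ruinTime {Ω : Type*} (Y : ℕ → Ω → ℕ) (u : ℕ) (ω : Ω) : ℕ∞ :=
  ⨅ (t : ℕ) (_ : 1 ≤ t ∧ riskProcess Y u t ω ≤ 0), (t : ℕ∞)

/-- The probability of ultimate ruin `ψ(u) = P(τ < ∞ | U(0) = u)`. -/
def ruinProb {Ω : Type*} [MeasurableSpace Ω] (P : Measure Ω) (Y : ℕ → Ω → ℕ) (u : ℕ) : ℝ :=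
  P.real {ω | ruinTime Y u ω < ⊤}

/-- The mean, in `[0, ∞]`, of a claim distribution. -/
def claimMean (μ : Measure ℕ) : ℝ≥0∞ := ∫⁻ y, (y : ℝ≥0∞) ∂μ

/-! ### Mixed Poisson distributions -/

/-- The Poisson law depends measurably on its parameter, so that mixing makes sense. -/
theorem measurable_poissonMeasure : Measurable (fun l : ℝ≥0 => poissonMeasure l) := by
  refine Measure.measurable_of_measurable_coe _ fun s _ => ?_
  simp only [poissonMeasure, Measure.sum_apply_of_countable, Measure.smul_apply]
  fun_prop

/-- `MP(F_Λ)`, where `ν` is the law of the non-negative random variable `Λ`: the law of `X` when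
`X` given `Λ = l` has a Poisson distribution with parameter `l`. -/
def mixedPoisson (ν : Measure ℝ≥0) : Measure ℕ := ν.bind (fun l => poissonMeasure l)

theorem mixedPoisson_singleton (ν : Measure ℝ≥0) (x : ℕ) :
    mixedPoisson ν {x} = ∫⁻ l, poissonMeasure l {x} ∂ν :=
  Measure.bind_apply (MeasurableSet.singleton x) measurable_poissonMeasure.aemeasurable

/-- The distribution function `F_Λ` of the law `ν` of `Λ`, on the real line. -/
def mixCdf (ν : Measure ℝ≥0) (x : ℝ) : ℝ := ν.real {l | (l : ℝ) ≤ x}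

/-- The tail `1 - F_Λ`. -/
def mixTail (ν : Measure ℝ≥0) (x : ℝ) : ℝ := 1 - mixCdf ν x

/-! ### Negative binomial mixtures -/

/-- The probability function `x ↦ (k + x - 1).choose x * p ^ k * (1 - p) ^ x` of the negative
binomial distribution with parameters `k` and `p`. For `k = 0` it is the unit mass at `0`
(see `nbPmf_zero`). -/
def nbPmf (k : ℕ) (p : ℝ) (x : ℕ) : ℝ := ((k + x - 1).choose x : ℝ) * p ^ k * (1 - p) ^ x

theorem nbPmf_zero (p : ℝ) (x : ℕ) : nbPmf 0 p x = if x = 0 then 1 else 0 := by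
  rcases x with _ | x <;> simp [nbPmf]

/-- `NBM(q, p)`: the law on `ℕ` with probability function `x ↦ ∑ k, q k * nb(k, p)(x)`. A weight
`q 0` is allowed as well and is a mass at `0`. -/
def nbMixture (q : ℕ → ℝ) (p : ℝ) : Measure ℕ :=
  Measure.sum fun x => ENNReal.ofReal (∑' k, q k * nbPmf k p x) • Measure.dirac x

/-- The weights `q(k, n) = F_Λ(k / n) - F_Λ((k - 1) / n)`. As `F_Λ` vanishes on the negative
half-line, `q(0, n) = F_Λ(0) = P(Λ = 0)` for `n ≥ 1`. -/
def mixWeight (ν : Measure ℝ≥0) (n k : ℕ) : ℝ :=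
  mixCdf ν ((k : ℝ) / n) - mixCdf ν (((k : ℝ) - 1) / n)

/-- The claim distribution `NBM(π_n, n / (n + 1))` with `π_n = (q(k, n))_k` that approximates
`MP(F_Λ)`. -/
def approxClaimLaw (ν : Measure ℝ≥0) (n : ℕ) : Measure ℕ :=
  nbMixture (mixWeight ν n) ((n : ℝ) / (n + 1))

/-! ### The coefficients -/

/-- `f_{Ne}(i) = (1 - F_Λ((i - 1) / n)) / ∑_{j ≥ 0} (1 - F_Λ(j / n))`, used for `i ≥ 1`. -/
def fNe (ν : Measure ℝ≥0) (n i : ℕ) : ℝ :=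
  mixTail ν (((i : ℝ) - 1) / n) / ∑' j : ℕ, mixTail ν ((j : ℝ) / n)

/-- The tail `1 - ∑_{i=1}^{k} f_{Ne}(i)` at `k`. -/
def tailNe (ν : Measure ℝ≥0) (n k : ℕ) : ℝ := 1 - ∑ i ∈ Finset.Icc 1 k, fNe ν n i

/-- `C_{0,n} = ∑_{j ≥ 0} (1 - F_Λ(j / n)) / n`. -/
def coeffZero (ν : Measure ℝ≥0) (n : ℕ) : ℝ := ∑' j : ℕ, mixTail ν ((j : ℝ) / n) / n

/-- The coefficients `C_{k,n}`; `coeff_of_pos` is the recursion in its usual form. -/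
def coeff (ν : Measure ℝ≥0) (n : ℕ) : ℕ → ℝ
  | 0 => coeffZero ν n
  | k + 1 => coeffZero ν n *
      (∑ i : Fin (k + 1), fNe ν n (i + 1) * coeff ν n (k - i) + tailNe ν n (k + 1))

theorem coeff_zero (ν : Measure ℝ≥0) (n : ℕ) : coeff ν n 0 = coeffZero ν n := by
  rw [coeff]

theorem coeff_of_pos (ν : Measure ℝ≥0) (n k : ℕ) (hk : 1 ≤ k) :
    coeff ν n k = coeff ν n 0 *
      (∑ i ∈ Finset.Icc 1 k, fNe ν n i * coeff ν n (k - i) + tailNe ν n k) := by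
  obtain ⟨k, rfl⟩ : ∃ m, k = m + 1 := ⟨k - 1, by omega⟩
  rw [coeff_zero, coeff, Fin.sum_univ_eq_sum_range
    (fun i => fNe ν n (i + 1) * coeff ν n (k - i)) (k + 1),
    ← Finset.Ico_add_one_right_eq_Icc, Finset.sum_Ico_eq_sum_range]
  congr 2
  refine Finset.sum_congr (by simp) fun i _ => ?_
  rw [show 1 + i = i + 1 by omega, show k + 1 - (i + 1) = k - i by omega]

/-! ### The laws above are probability distributions -/

theorem hasSum_nbPmf (k : ℕ) {p : ℝ} (hp : 0 < p) (hp1 : p ≤ 1) : HasSum (nbPmf k p) 1 := by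
  rcases k with _ | k
  · have : nbPmf 0 p = fun x => if x = 0 then 1 else 0 := funext (nbPmf_zero p)
    rw [this]; exact hasSum_ite_eq 0 1
  · have h := (hasSum_choose_mul_geometric_of_norm_lt_one (𝕜 := ℝ) k (r := 1 - p)
      (by rw [Real.norm_eq_abs, abs_lt]; constructor <;> linarith)).mul_left (p ^ (k + 1))
    have e : p ^ (k + 1) * (1 / (1 - (1 - p)) ^ (k + 1)) = 1 := by
      rw [sub_sub_cancel]; field_simp
    rw [e] at h
    have e2 : nbPmf (k + 1) p = fun x => p ^ (k + 1) * (((x + k).choose k : ℝ) * (1 - p) ^ x) := by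
      funext x
      rw [nbPmf, show k + 1 + x - 1 = x + k by omega, Nat.choose_symm_add]; ring
    rwa [e2]

theorem nbPmf_nonneg (k : ℕ) {p : ℝ} (hp : 0 < p) (hp1 : p ≤ 1) (x : ℕ) : 0 ≤ nbPmf k p x := by
  unfold nbPmf
  have : 0 ≤ 1 - p := by linarith
  positivity

theorem isProbabilityMeasure_nbMixture {q : ℕ → ℝ} {p : ℝ} (hq : ∀ k, 0 ≤ q k) (hq1 : HasSum q 1)
    (hp : 0 < p) (hp1 : p ≤ 1) : IsProbabilityMeasure (nbMixture q p) := by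
  have h0 : ∀ k x, 0 ≤ q k * nbPmf k p x := fun k x => mul_nonneg (hq k) (nbPmf_nonneg k hp hp1 x)
  have hs : ∀ x, Summable fun k => q k * nbPmf k p x := fun x =>
    Summable.of_nonneg_of_le (fun k => h0 k x) (fun k => mul_le_of_le_one_right (hq k)
      (le_hasSum (hasSum_nbPmf k hp hp1) x fun y _ => nbPmf_nonneg k hp hp1 y)) hq1.summable
  constructor
  rw [nbMixture, Measure.sum_apply _ MeasurableSet.univ]
  simp only [Measure.smul_apply, measure_univ, smul_eq_mul, mul_one]
  simp_rw [fun x => ENNReal.ofReal_tsum_of_nonneg (fun k => h0 k x) (hs x)]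
  rw [ENNReal.tsum_comm]
  have : ∀ k, ∑' x, ENNReal.ofReal (q k * nbPmf k p x) = ENNReal.ofReal (q k) := fun k => by
    have h := (hasSum_nbPmf k hp hp1).mul_left (q k)
    rw [← ENNReal.ofReal_tsum_of_nonneg (h0 k) h.summable, h.tsum_eq, mul_one]
  simp_rw [this]
  rw [← ENNReal.ofReal_tsum_of_nonneg hq hq1.summable, hq1.tsum_eq, ENNReal.ofReal_one]

/-- The approximating claim laws are genuine probability distributions. -/
theorem isProbabilityMeasure_approxClaimLaw (ν : Measure ℝ≥0) [IsProbabilityMeasure ν] (n : ℕ)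
    (hn : 1 ≤ n) : IsProbabilityMeasure (approxClaimLaw ν n) := by
  have hn0 : (0 : ℝ) < n := by exact_mod_cast hn
  have mono : Monotone (mixCdf ν) := fun x y hxy =>
    measureReal_mono (fun l (hl : (l : ℝ) ≤ x) => hl.trans hxy)
  refine isProbabilityMeasure_nbMixture (fun k => ?_) ?_ (by positivity)
    (by rw [div_le_one (by positivity)]; linarith)
  · exact sub_nonneg.2 (mono (by gcongr; linarith))
  · have hpos : ∀ k, 0 ≤ mixWeight ν n k := fun k => sub_nonneg.2 (mono (by gcongr; linarith))
    rw [hasSum_iff_tendsto_nat_of_nonneg hpos]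
    have hsum : ∀ m : ℕ, ∑ i ∈ Finset.range m, mixWeight ν n i = mixCdf ν (((m : ℝ) - 1) / n) := by
      intro m
      induction m with
      | zero =>
        have : {l : ℝ≥0 | (l : ℝ) ≤ ((0 : ℕ) - 1 : ℝ) / n} = ∅ := by
          ext l
          have : ((0 : ℕ) - 1 : ℝ) / n < 0 := by
            apply div_neg_of_neg_of_pos _ hn0; norm_num
          simpa using this.trans_le l.2
        simp only [Finset.range_zero, Finset.sum_empty, mixCdf, this, measureReal_empty]
      | succ m ih => rw [Finset.sum_range_succ, ih, mixWeight]; push_cast; ring_nf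
    simp_rw [hsum]
    have h1 : Tendsto (mixCdf ν) atTop (𝓝 1) := by
      have := tendsto_measure_iUnion_atTop (μ := ν) (s := fun x : ℝ => {l : ℝ≥0 | (l : ℝ) ≤ x})
        (fun x y hxy l (hl : (l : ℝ) ≤ x) => hl.trans hxy)
      have hu : (⋃ x : ℝ, {l : ℝ≥0 | (l : ℝ) ≤ x}) = Set.univ :=
        Set.eq_univ_of_forall fun l => Set.mem_iUnion.2 ⟨(l : ℝ), le_refl (l : ℝ)⟩
      rw [hu, measure_univ] at this
      exact (ENNReal.tendsto_toReal ENNReal.one_ne_top).comp this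
    refine h1.comp ?_
    exact (tendsto_atTop_add_const_right _ (-1) tendsto_natCast_atTop_atTop).atTop_div_const hn0

theorem isProbabilityMeasure_mixedPoisson (ν : Measure ℝ≥0) [IsProbabilityMeasure ν] :
    IsProbabilityMeasure (mixedPoisson ν) := by
  constructor
  rw [mixedPoisson, Measure.bind_apply MeasurableSet.univ measurable_poissonMeasure.aemeasurable]
  simp

end

/-! Everything is done for the survival probability `φ = 1 - ψ`. Conditioning on the first claim
gives `φ u = ∑_{y ≤ u} f y * φ (u + 1 - y)`, with `f` the claim probabilities
(`survivalProb_eq_sum`). Telescoping this recursion, with `φ → 1` from the strong law, gives `φ 0 =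
1 - mean`. As `f 0 ≠ 0`, each `φ u` is a continuous function of the mean and finitely many `f y`, so
convergence of the means and pointwise convergence of the claim probabilities suffice for the limit.

Both follow from one observation (`mixWeight_eq`): `q(k, n) = P(⌈nΛ⌉ = k)`, so `X_n` is negative
binomial with random index `⌈nΛ⌉`. Its mean `E⌈nΛ⌉ / n` lies between `EΛ` and `EΛ + 1/n`, and
`nb(⌈nλ⌉, n/(n+1))` tends to the Poisson law of parameter `λ`; dominated convergence finishes.

For the formula (`hasSum_ruinProb`), `D k = 1 - coeff ν n k` satisfies a renewal equation, which
gives its generating function. Mixing `D` over `NegBin(u, 1/(1+n))` and summing against `s ^ u`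
evaluates that function at `r = n/(n+1-s)`. The generating function of the claims at `s` is that of
`⌈nΛ⌉` at the same `r`, so the mixture and `φ` have equal generating functions on `(0, 1)` and
agree. -/

noncomputable section

/-! ### Ruin in the Gerber–Dickson model -/

/-- The event that ruin never occurs when the initial capital is `u`. -/
def survivalSet {Ω : Type*} (Y : ℕ → Ω → ℕ) (u : ℕ) : Set Ω :=
  {ω | ∀ t, ∑ i ∈ Finset.range (t + 1), Y i ω < u + (t + 1)}

/-- The probability that ruin never occurs when the initial capital is `u`. -/
def survivalProb {Ω : Type*} [MeasurableSpace Ω] (P : Measure Ω) (Y : ℕ → Ω → ℕ) (u : ℕ) : ℝ :=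
  P.real (survivalSet Y u)

theorem measurableSet_survivalSet {Ω : Type*} {m : MeasurableSpace Ω} {Y : ℕ → Ω → ℕ}
    (hY : ∀ i, Measurable (Y i)) (u : ℕ) : MeasurableSet (survivalSet Y u) := by
  have : survivalSet Y u =
      ⋂ t, (fun ω => ∑ i ∈ Finset.range (t + 1), Y i ω) ⁻¹' Set.Iio (u + (t + 1)) := by
    ext ω; simp [survivalSet]
  rw [this]
  exact MeasurableSet.iInter fun t =>
    (Finset.measurable_sum _ fun i _ => hY i) measurableSet_Iio

theorem ruinTime_lt_top_iff {Ω : Type*} (Y : ℕ → Ω → ℕ) (u : ℕ) (ω : Ω) :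
    ruinTime Y u ω < ⊤ ↔ ω ∉ survivalSet Y u := by
  have h1 : ruinTime Y u ω < ⊤ ↔ ∃ t : ℕ, 1 ≤ t ∧ riskProcess Y u t ω ≤ 0 := by
    simp [ruinTime, iInf_lt_iff]
  rw [h1]
  simp only [survivalSet, Set.mem_ofPred_eq, not_forall, not_lt, riskProcess]
  constructor
  · rintro ⟨t, ht, h⟩
    obtain ⟨t, rfl⟩ : ∃ s, t = s + 1 := ⟨t - 1, by omega⟩
    exact ⟨t, by zify; push_cast at h; linarith⟩
  · rintro ⟨t, h⟩
    exact ⟨t + 1, by omega, by zify at h; push_cast; linarith⟩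

namespace IsClaimSequence

variable {Ω : Type*} [MeasurableSpace Ω] {P : Measure Ω} {Y : ℕ → Ω → ℕ} {μ : Measure ℕ}

theorem ruinProb_eq (hY : IsClaimSequence P Y μ) (u : ℕ) :
    ruinProb P Y u = 1 - survivalProb P Y u := by
  have := hY.isProbabilityMeasure
  have h : {ω | ruinTime Y u ω < ⊤} = (survivalSet Y u)ᶜ := by
    ext ω; exact ruinTime_lt_top_iff Y u ω
  rw [ruinProb, h, probReal_compl_eq_one_sub (measurableSet_survivalSet hY.measurable u),
    survivalProb]

theorem survivalProb_nonneg (u : ℕ) : 0 ≤ survivalProb P Y u := measureReal_nonneg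

theorem survivalProb_le_one (hY : IsClaimSequence P Y μ) (u : ℕ) : survivalProb P Y u ≤ 1 :=
  have := hY.isProbabilityMeasure
  measureReal_le_one

theorem shift (hY : IsClaimSequence P Y μ) : IsClaimSequence P (fun i => Y (i + 1)) μ where
  isProbabilityMeasure := hY.isProbabilityMeasure
  measurable _ := hY.measurable _
  law _ := hY.law _
  indep := hY.indep.precomp (g := fun i : ℕ => i + 1) (add_left_injective 1)

/-- Independence and the common law make the joint law a product measure, so survival depends on `μ`
alone. This lets the shifted claims be replaced by the original ones. -/
theorem survivalProb_eq_infinitePi (hY : IsClaimSequence P Y μ) (u : ℕ) :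
    survivalProb P Y u = (Measure.infinitePi fun _ : ℕ => μ).real
      (survivalSet (fun i (y : ℕ → ℕ) => y i) u) := by
  have := hY.isProbabilityMeasure
  have h := hY.indep.map_fun_eq_infinitePi_map hY.measurable
  rw [funext hY.law] at h
  rw [← h, measureReal_def, Measure.map_apply (measurable_pi_iff.2 hY.measurable)
    (measurableSet_survivalSet (fun i => measurable_pi_apply i) u)]
  rfl

/-- The first claim is independent of the survival after it. -/
theorem measureReal_first_inter (hY : IsClaimSequence P Y μ) (y u : ℕ) :
    P.real (Y 0 ⁻¹' {y} ∩ survivalSet (fun i => Y (i + 1)) u) =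
      μ.real {y} * survivalProb P Y u := by
  have hind := indep_iSup_of_disjoint (fun i => (hY.measurable i).comap_le) hY.indep.iIndep
    (S := {0}) (T := Set.Ici 1) (by simp)
  rw [Indep_iff] at hind
  have h := hind (Y 0 ⁻¹' {y}) (survivalSet (fun i => Y (i + 1)) u)
    (by
      rw [iSup_singleton]
      exact ⟨{y}, measurableSet_singleton y, rfl⟩)
    (measurableSet_survivalSet (fun i => (comap_measurable (Y (i + 1))).mono
      (le_iSup₂_of_le (i + 1) (by simp) le_rfl) le_rfl) u)
  rw [measureReal_def, h, ENNReal.toReal_mul, ← hY.law 0, measureReal_def,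
    Measure.map_apply (hY.measurable 0) (measurableSet_singleton y),
    hY.survivalProb_eq_infinitePi, ← hY.shift.survivalProb_eq_infinitePi]
  rfl

/-- Conditioning on the first claim. -/
theorem survivalProb_eq_sum (hY : IsClaimSequence P Y μ) (u : ℕ) :
    survivalProb P Y u =
      ∑ y ∈ Finset.range (u + 1), μ.real {y} * survivalProb P Y (u + 1 - y) := by
  have := hY.isProbabilityMeasure
  have e : survivalSet Y u = ⋃ y ∈ Finset.range (u + 1),
      (Y 0 ⁻¹' {y} ∩ survivalSet (fun i => Y (i + 1)) (u + 1 - y)) := by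
    ext ω
    simp only [survivalSet, Set.mem_ofPred_eq, Finset.mem_range, Set.mem_iUnion, Set.mem_inter_iff,
      Set.mem_preimage, Set.mem_singleton_iff, exists_prop]
    constructor
    · intro h
      have h0 := h 0
      simp only [zero_add, Finset.sum_range_one] at h0
      refine ⟨Y 0 ω, h0, rfl, fun t => ?_⟩
      have := h (t + 1)
      rw [Finset.sum_range_succ'] at this
      omega
    · rintro ⟨y, hy, rfl, h⟩ t
      rcases t with _ | t
      · simpa using hy
      · have := h t
        rw [Finset.sum_range_succ']
        omega
  rw [survivalProb, e, measureReal_biUnion_finset]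
  · exact Finset.sum_congr rfl fun y _ => hY.measureReal_first_inter y _
  · intro y _ z _ hyz
    refine Disjoint.mono Set.inter_subset_left Set.inter_subset_left ?_
    exact Disjoint.preimage _ (by simpa using hyz)
  · intro y _
    exact (hY.measurable 0 (measurableSet_singleton y)).inter
      (measurableSet_survivalSet (fun i => hY.measurable _) _)

theorem isProbabilityMeasure_law (hY : IsClaimSequence P Y μ) : IsProbabilityMeasure μ := by
  have := hY.isProbabilityMeasure
  rw [← hY.law 0]
  exact Measure.isProbabilityMeasure_map (hY.measurable 0).aemeasurable

theorem integrable_first (hY : IsClaimSequence P Y μ) (hμ : claimMean μ < ⊤) :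
    Integrable (fun ω => (Y 0 ω : ℝ)) P := by
  refine ⟨(measurable_from_nat.comp (hY.measurable 0)).aestronglyMeasurable, ?_⟩
  rw [hasFiniteIntegral_iff_ofReal (Eventually.of_forall fun _ => by positivity)]
  rw [claimMean, ← hY.law 0, lintegral_map measurable_from_nat (hY.measurable 0)] at hμ
  simpa using hμ

theorem integral_first (hY : IsClaimSequence P Y μ) :
    ∫ ω, (Y 0 ω : ℝ) ∂P = (claimMean μ).toReal := by
  have hm : Measurable fun ω => (Y 0 ω : ℝ) := measurable_from_nat.comp (hY.measurable 0)
  rw [integral_eq_lintegral_of_nonneg_ae (Eventually.of_forall fun _ => by positivity)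
    hm.aestronglyMeasurable,
    claimMean, ← hY.law 0, lintegral_map measurable_from_nat (hY.measurable 0)]
  simp

/-- With net profit, ruin becomes unlikely when the initial capital is large. -/
theorem tendsto_survivalProb (hY : IsClaimSequence P Y μ) (hμ : claimMean μ < 1) :
    Tendsto (survivalProb P Y) atTop (𝓝 1) := by
  have := hY.isProbabilityMeasure
  have hm : Measurable (fun n : ℕ => (n : ℝ)) := measurable_from_nat
  have slln := strong_law_ae_real (fun i ω => (Y i ω : ℝ))
    (hY.integrable_first (hμ.trans ENNReal.one_lt_top))
    (fun i j hij => (hY.indep.indepFun hij).comp hm hm)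
    (fun i => IdentDistrib.comp (f := Y i) (g := Y 0) ⟨(hY.measurable i).aemeasurable,
      (hY.measurable 0).aemeasurable, by rw [hY.law, hY.law]⟩ hm)
  have hint := hY.integral_first
  have hlt : (claimMean μ).toReal < 1 := by
    rw [← ENNReal.toReal_one]
    exact (ENNReal.toReal_lt_toReal (hμ.trans ENNReal.one_lt_top).ne ENNReal.one_ne_top).2 hμ
  have hae : ∀ᵐ ω ∂P, ω ∈ ⋃ u, survivalSet Y u := by
    filter_upwards [slln] with ω hω
    obtain ⟨N, hN⟩ := eventually_atTop.1 (hω.eventually (gt_mem_nhds (hint.trans_lt hlt)))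
    -- A capital equal to the first `N` claims covers every time before `N`; from `N` on the average
    -- claim is below 1.
    refine Set.mem_iUnion.2 ⟨∑ i ∈ Finset.range N, Y i ω, fun t => ?_⟩
    rcases le_or_gt N (t + 1) with h | h
    · have := hN (t + 1) h
      rw [div_lt_one (by positivity)] at this
      have h' : ∑ i ∈ Finset.range (t + 1), Y i ω < t + 1 := by exact_mod_cast this
      omega
    · have : ∑ i ∈ Finset.range (t + 1), Y i ω ≤ ∑ i ∈ Finset.range N, Y i ω :=
        Finset.sum_le_sum_of_subset (Finset.range_subset_range.2 h.le)
      omega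
  have hmono : Monotone (survivalSet Y) := fun u v huv ω h t => (h t).trans_le (by omega)
  have h1 : P (⋃ u, survivalSet Y u) = 1 :=
    (prob_compl_eq_zero_iff (MeasurableSet.iUnion fun u =>
      measurableSet_survivalSet hY.measurable u)).1 hae
  have h2 := tendsto_measure_iUnion_atTop (μ := P) hmono
  rw [h1] at h2
  exact (ENNReal.tendsto_toReal ENNReal.one_ne_top).comp h2

end IsClaimSequence

/-! ### Claim distributions and their tails -/

theorem claimMean_eq_tsum (μ : Measure ℕ) : claimMean μ = ∑' j : ℕ, μ (Set.Ioi j) := by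
  have h : ∀ y : ℕ, (y : ℝ≥0∞) = ∑' j : ℕ, (Set.Ioi j).indicator 1 y := by
    intro y
    rw [tsum_eq_sum (s := Finset.range y) fun j hj => by simpa using hj,
      Finset.sum_congr rfl (g := fun _ => 1) fun j hj =>
        Set.indicator_of_mem (Set.mem_Ioi.2 (Finset.mem_range.1 hj)) _]
    simp
  rw [claimMean, lintegral_congr h, lintegral_tsum fun j => (measurable_of_countable _).aemeasurable]
  simp_rw [lintegral_indicator_one measurableSet_Ioi]

theorem hasSum_tail_of_claimMean_lt_top {μ : Measure ℕ} [IsProbabilityMeasure μ]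
    (h : claimMean μ < ⊤) : HasSum (fun j => μ.real (Set.Ioi j)) (claimMean μ).toReal := by
  have hs : ∑' j : ℕ, μ (Set.Ioi j) ≠ ⊤ := by rw [← claimMean_eq_tsum]; exact h.ne
  rw [claimMean_eq_tsum, ENNReal.tsum_toReal_eq fun j => measure_ne_top μ _]
  exact ENNReal.hasSum_toReal hs

theorem tail_zero (μ : Measure ℕ) [IsProbabilityMeasure μ] :
    μ.real (Set.Ioi 0) = 1 - μ.real {0} := by
  rw [← probReal_compl_eq_one_sub (measurableSet_singleton 0)]
  congr 1; ext y; simp [Nat.pos_iff_ne_zero]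

theorem tail_succ (μ : Measure ℕ) [IsProbabilityMeasure μ] (j : ℕ) :
    μ.real (Set.Ioi (j + 1)) = μ.real (Set.Ioi j) - μ.real {j + 1} := by
  rw [← measureReal_sdiff (by simp) (measurableSet_singleton _)]
  congr 1; ext y; simp; omega

theorem hasSum_measureReal_singleton (μ : Measure ℕ) [IsProbabilityMeasure μ] :
    HasSum (fun k => μ.real {k}) 1 := by
  have h : ∑' k : ℕ, μ {k} = 1 := by
    rw [← measure_univ (μ := μ), ← Measure.tsum_indicator_apply_singleton μ _ MeasurableSet.univ]
    simp
  have := ENNReal.hasSum_toReal (f := fun k : ℕ => μ {k}) (by rw [h]; exact ENNReal.one_ne_top)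
  rwa [← ENNReal.tsum_toReal_eq fun j => measure_ne_top μ _, h] at this

/-! ### The recursion for the survival probability -/

/-- With `T` the tail of `f`, the recursion telescopes to the identity `key`. Letting `k → ∞` there,
with `T` as summable bound, replaces every `φ` on the right by 1. -/
theorem eq_one_sub_of_recursion {φ f T : ℕ → ℝ} {m : ℝ}
    (hrec : ∀ u, φ u = ∑ y ∈ Finset.range (u + 1), f y * φ (u + 1 - y))
    (hT0 : T 0 = 1 - f 0) (hT : ∀ j, T (j + 1) = T j - f (j + 1))
    (hφ : Tendsto φ atTop (𝓝 1)) (hb : ∀ u, ‖φ u‖ ≤ 1) (hs : HasSum T m) : φ 0 = 1 - m := by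
  have key : ∀ k, φ 0 = φ (k + 1) - ∑ j ∈ Finset.range (k + 1), φ (k + 1 - j) * T j := by
    intro k
    induction k with
    | zero => rw [hrec 0]; simp [hT0]; ring
    | succ k ih =>
      have h := hrec (k + 1)
      rw [Finset.sum_range_succ'] at h
      rw [ih, Finset.sum_range_succ' _ (k + 1)]
      simp only [Nat.add_sub_add_right, Nat.sub_zero] at h ⊢
      simp_rw [hT, mul_sub, Finset.sum_sub_distrib]
      simp_rw [mul_comm (f _)] at h
      rw [hT0]
      linarith
  have hlim : Tendsto (fun k => ∑' j, if j ∈ Finset.range (k + 1) then φ (k + 1 - j) * T j else 0)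
      atTop (𝓝 (∑' j, 1 * T j)) := by
    refine tendsto_tsum_of_dominated_convergence hs.summable.norm (fun j => ?_)
      (Eventually.of_forall fun k j => ?_)
    · have h1 : Tendsto (fun k => φ (k + 1 - j) * T j) atTop (𝓝 (1 * T j)) :=
        (hφ.comp ((tendsto_sub_atTop_nat j).comp (tendsto_add_atTop_nat 1))).mul_const _
      refine h1.congr' ?_
      filter_upwards [eventually_ge_atTop j] with k hk
      rw [if_pos (by simp; omega)]
    · split_ifs
      · rw [norm_mul]
        exact mul_le_of_le_one_left (norm_nonneg _) (hb _)
      · simp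
  have h2 : Tendsto (fun k => φ (k + 1) - ∑' j, if j ∈ Finset.range (k + 1)
      then φ (k + 1 - j) * T j else 0) atTop (𝓝 (1 - ∑' j, 1 * T j)) :=
    (hφ.comp (tendsto_add_atTop_nat 1)).sub hlim
  simp only [one_mul, hs.tsum_eq] at h2
  refine tendsto_nhds_unique (tendsto_const_nhds.congr fun k => ?_) h2
  rw [key k, tsum_eq_sum (s := Finset.range (k + 1)) fun j hj => by rw [if_neg hj]]
  congr 1
  exact Finset.sum_congr rfl fun j hj => by rw [if_pos hj]

/-- Solutions of the recursion depend continuously on its coefficients and its initial value. -/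
theorem tendsto_of_recursion {φ : ℕ → ℕ → ℝ} {f : ℕ → ℕ → ℝ} {φ' f' : ℕ → ℝ}
    (hrec : ∀ᶠ n in atTop, ∀ u, φ n u = ∑ y ∈ Finset.range (u + 1), f n y * φ n (u + 1 - y))
    (hrec' : ∀ u, φ' u = ∑ y ∈ Finset.range (u + 1), f' y * φ' (u + 1 - y))
    (hf : ∀ y, Tendsto (fun n => f n y) atTop (𝓝 (f' y))) (hf0 : f' 0 ≠ 0)
    (h0 : Tendsto (fun n => φ n 0) atTop (𝓝 (φ' 0))) (u : ℕ) :
    Tendsto (fun n => φ n u) atTop (𝓝 (φ' u)) := by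
  -- The term `y = 0` carries the highest index, so division by `g 0` turns the implicit equation
  -- into a forward recursion.
  have solve : ∀ {g ψ : ℕ → ℝ}, g 0 ≠ 0 →
      (∀ u, ψ u = ∑ y ∈ Finset.range (u + 1), g y * ψ (u + 1 - y)) → ∀ u,
      ψ (u + 1) = (ψ u - ∑ y ∈ Finset.range u, g (y + 1) * ψ (u - y)) / g 0 := by
    intro g ψ hg h u
    rw [eq_div_iff hg]
    rw [h u]
    rw [Finset.sum_range_succ']
    simp only [Nat.add_sub_add_right, Nat.sub_zero]
    ring
  induction u using Nat.strong_induction_on with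
  | _ u ih =>
    rcases u with _ | u
    · exact h0
    · rw [solve hf0 hrec' u]
      have : Tendsto (fun n => (φ n u - ∑ y ∈ Finset.range u, f n (y + 1) * φ n (u - y)) / f n 0)
          atTop (𝓝 ((φ' u - ∑ y ∈ Finset.range u, f' (y + 1) * φ' (u - y)) / f' 0)) :=
        ((ih u (by omega)).sub (tendsto_finsetSum _ fun y _ =>
          (hf (y + 1)).mul (ih (u - y) (by omega)))).div (hf 0) hf0
      refine this.congr' ?_
      filter_upwards [hrec, (hf 0).eventually_ne hf0] with n hn hn0
      exact (solve hn0 hn u).symm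

/-! ### Survival from zero capital -/

namespace IsClaimSequence

variable {Ω : Type*} [MeasurableSpace Ω] {P : Measure Ω} {Y : ℕ → Ω → ℕ} {μ : Measure ℕ}

theorem survivalProb_zero (hY : IsClaimSequence P Y μ) (hμ : claimMean μ < 1) :
    survivalProb P Y 0 = 1 - (claimMean μ).toReal := by
  have := hY.isProbabilityMeasure_law
  refine eq_one_sub_of_recursion hY.survivalProb_eq_sum (tail_zero μ) (tail_succ μ)
    (hY.tendsto_survivalProb hμ) (fun u => ?_)
    (hasSum_tail_of_claimMean_lt_top (hμ.trans ENNReal.one_lt_top))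
  rw [Real.norm_of_nonneg (survivalProb_nonneg u)]
  exact hY.survivalProb_le_one u

/-- Otherwise the recursion at `u = 0` gives zero survival probability, against `1 - mean > 0`. -/
theorem law_zero_ne_zero (hY : IsClaimSequence P Y μ) (hμ : claimMean μ < 1) :
    μ.real {0} ≠ 0 := by
  intro h
  have h1 := hY.survivalProb_zero hμ
  rw [hY.survivalProb_eq_sum] at h1
  have hlt : (claimMean μ).toReal < 1 := by
    rw [← ENNReal.toReal_one]
    exact (ENNReal.toReal_lt_toReal (hμ.trans ENNReal.one_lt_top).ne ENNReal.one_ne_top).2 hμ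
  simp [h] at h1
  linarith

end IsClaimSequence

/-! ### Sums of non-negative double families and power series -/

/-- Tonelli for real double series; it justifies each exchange of mixing and generating function. -/
theorem hasSum_tsum_of_nonneg {a : ℕ → ℕ → ℝ} {b : ℕ → ℝ} {c : ℝ} (ha : ∀ k x, 0 ≤ a k x)
    (hb : ∀ k, HasSum (a k) (b k)) (hc : HasSum b c) :
    (∀ x, Summable fun k => a k x) ∧ HasSum (fun x => ∑' k, a k x) c := by
  have hs : Summable (fun z : ℕ × ℕ => a z.1 z.2) :=
    (summable_prod_of_nonneg fun z => ha z.1 z.2).2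
      ⟨fun k => (hb k).summable, by simpa only [(hb _).tsum_eq] using hc.summable⟩
  have h1 : HasSum (fun z : ℕ × ℕ => a z.1 z.2) c := by
    have := hs.hasSum.prod_fiberwise hb
    rw [← this.unique hc]; exact hs.hasSum
  have hs' : Summable (fun z : ℕ × ℕ => a z.2 z.1) := (Equiv.prodComm ℕ ℕ).summable_iff.2 hs
  have h2 : HasSum (fun z : ℕ × ℕ => a z.2 z.1) c := (Equiv.prodComm ℕ ℕ).hasSum_iff.2 h1
  have hx : ∀ x, Summable fun k => a k x := hs'.prod_factor
  exact ⟨hx, h2.prod_fiberwise fun x => (hx x).hasSum⟩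

theorem summable_mul_pow_of_bounded {a : ℕ → ℝ} {C s : ℝ} (ha : ∀ k, ‖a k‖ ≤ C) (hs : 0 ≤ s)
    (hs1 : s < 1) : Summable fun k => ‖a k * s ^ k‖ := by
  refine Summable.of_nonneg_of_le (fun _ => norm_nonneg _) (fun k => ?_)
    ((summable_geometric_of_lt_one hs hs1).mul_left C)
  rw [norm_mul, Real.norm_of_nonneg (pow_nonneg hs k)]
  exact mul_le_mul_of_nonneg_right (ha k) (pow_nonneg hs k)

/-- A bounded sequence is determined by its generating function on `(0, 1)`. -/
theorem eq_zero_of_tsum_mul_pow_eq_zero {d : ℕ → ℝ} {C : ℝ} (hd : ∀ k, ‖d k‖ ≤ C)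
    (h : ∀ s : ℝ, 0 < s → s < 1 → ∑' k, d k * s ^ k = 0) (k : ℕ) : d k = 0 := by
  induction k using Nat.strong_induction_on with
  | _ m ih =>
    have hC : 0 ≤ C := (norm_nonneg _).trans (hd 0)
    have hzero : ∀ s : ℝ, 0 < s → s < 1 → ∑' k, d (k + m) * s ^ k = 0 := by
      intro s hs hs1
      have h1 := (summable_mul_pow_of_bounded hd hs.le hs1).of_norm.sum_add_tsum_nat_add m
      rw [h s hs hs1, Finset.sum_eq_zero fun i hi => by rw [ih i (by simpa using hi), zero_mul],
        zero_add] at h1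
      simp_rw [pow_add, ← mul_assoc] at h1
      rw [tsum_mul_right] at h1
      exact (mul_eq_zero.1 h1).resolve_right (pow_pos hs m).ne'
    -- After division by `s ^ m`, the points `s = 2 ^ -(j+1) → 0` isolate the constant term `d m`.
    have hlim : Tendsto (fun j : ℕ => ∑' k, d (k + m) * ((1 / 2 : ℝ) ^ (j + 1)) ^ k) atTop
        (𝓝 (∑' k, d (k + m) * 0 ^ k)) := by
      refine tendsto_tsum_of_dominated_convergence (bound := fun k => C * (1 / 2) ^ k)
        ((summable_geometric_of_lt_one (by norm_num) (by norm_num)).mul_left C) (fun k => ?_)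
        (Eventually.of_forall fun j k => ?_)
      · exact (((tendsto_pow_atTop_nhds_zero_of_lt_one (by norm_num) (by norm_num)).comp
          (tendsto_add_atTop_nat 1)).pow k).const_mul _
      · rw [norm_mul, norm_pow, norm_pow, Real.norm_of_nonneg (r := 1 / 2) (by norm_num)]
        refine mul_le_mul (hd _) (pow_le_pow_left₀ (by positivity) ?_ k) (by positivity) hC
        exact pow_le_of_le_one (by norm_num) (by norm_num) (by omega)
    rw [tsum_eq_single 0 fun k hk => by rw [zero_pow hk, mul_zero]] at hlim
    simp only [zero_add, pow_zero, mul_one] at hlim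
    refine tendsto_nhds_unique hlim (tendsto_const_nhds.congr fun j => ?_)
    exact (hzero _ (by positivity) (pow_lt_one₀ (by norm_num) (by norm_num) (by omega))).symm

/-- The generating function of a convolution of bounded sequences. -/
theorem tsum_mul_tsum_mul_pow {a b : ℕ → ℝ} {A B s : ℝ} (ha : ∀ k, ‖a k‖ ≤ A)
    (hb : ∀ k, ‖b k‖ ≤ B) (hs : 0 ≤ s) (hs1 : s < 1) :
    (∑' k, a k * s ^ k) * (∑' k, b k * s ^ k) =
      ∑' k, (∑ i ∈ Finset.range (k + 1), a i * b (k - i)) * s ^ k := by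
  rw [tsum_mul_tsum_eq_tsum_sum_range_of_summable_norm (summable_mul_pow_of_bounded ha hs hs1)
    (summable_mul_pow_of_bounded hb hs hs1)]
  refine tsum_congr fun k => ?_
  rw [Finset.sum_mul]
  refine Finset.sum_congr rfl fun i hi => ?_
  have : k = i + (k - i) := by have := Finset.mem_range.1 hi; omega
  conv_rhs => rw [this, pow_add, add_tsub_cancel_left]
  ring

/-- The generating function of a probability function in terms of that of its tail. -/
theorem one_sub_mul_tsum_tail (κ : Measure ℕ) [IsProbabilityMeasure κ] {r : ℝ} (hr : 0 ≤ r)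
    (hr1 : r < 1) :
    (1 - r) * ∑' k, κ.real (Set.Ioi k) * r ^ k = 1 - ∑' k, κ.real {k} * r ^ k := by
  have hb : ∀ s : ℕ → Set ℕ, ∀ k, ‖κ.real (s k)‖ ≤ 1 := fun s k => by
    rw [Real.norm_of_nonneg measureReal_nonneg]; exact measureReal_le_one
  have hT := (summable_mul_pow_of_bounded (hb Set.Ioi) hr hr1).of_norm
  have hq := (summable_mul_pow_of_bounded (hb fun k => {k}) hr hr1).of_norm
  have h1 := hT.tsum_eq_zero_add
  have h2 := hq.tsum_eq_zero_add
  have h3 : ∑' k : ℕ, κ.real {k + 1} * r ^ (k + 1) = r * (∑' k, κ.real (Set.Ioi k) * r ^ k) -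
      ∑' k : ℕ, κ.real (Set.Ioi (k + 1)) * r ^ (k + 1) := by
    rw [← tsum_mul_left, ← (hT.mul_left r).tsum_sub ((summable_nat_add_iff 1).2 hT)]
    refine tsum_congr fun k => ?_
    rw [tail_succ]; ring
  rw [tail_zero] at h1
  simp only [pow_zero, mul_one] at h1 h2
  linarith

/-! ### Generating functions of the negative binomial distributions -/

theorem nbPmf_le_one (k : ℕ) {p : ℝ} (hp : 0 < p) (hp1 : p ≤ 1) (x : ℕ) : nbPmf k p x ≤ 1 :=
  le_hasSum (hasSum_nbPmf k hp hp1) x fun y _ => nbPmf_nonneg k hp hp1 y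

/-- Exponential tilting: the summand is a constant times the negative binomial probability with
success parameter `1 - (1 - p) * s`, whose total mass is 1. -/
theorem hasSum_nbPmf_mul_pow (k : ℕ) {p s : ℝ} (hp : 0 < p) (hp1 : p ≤ 1) (hs : 0 ≤ s)
    (hs1 : s ≤ 1) : HasSum (fun x => nbPmf k p x * s ^ x) ((p / (1 - (1 - p) * s)) ^ k) := by
  have hpos : 0 < 1 - (1 - p) * s := by nlinarith
  have h := (hasSum_nbPmf k hpos (by nlinarith)).mul_right ((p / (1 - (1 - p) * s)) ^ k)
  rw [one_mul] at h
  refine h.congr_fun fun x => ?_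
  simp only [nbPmf, sub_sub_cancel, div_pow, mul_pow]
  field_simp

/-- The generating function of the negative binomial probabilities in the number of successes. -/
theorem hasSum_nbPmf_mul_pow_left (k : ℕ) {p s : ℝ} (hp : 0 < p) (hp1 : p ≤ 1) (hs : 0 ≤ s)
    (hs1 : s < 1) : HasSum (fun u => nbPmf u p k * s ^ u)
      (p * s / (1 - p * s) * ((1 - p) / (1 - p * s)) ^ k + if k = 0 then 1 else 0) := by
  have hps : p * s < 1 := by nlinarith
  have hps0 : 0 ≤ p * s := by positivity
  have hne : 1 - p * s ≠ 0 := by linarith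
  have h := (hasSum_choose_mul_geometric_of_norm_lt_one (𝕜 := ℝ) k (r := p * s)
    (by rwa [Real.norm_of_nonneg hps0])).mul_left (p * s * (1 - p) ^ k)
  have h2 : HasSum (fun u => nbPmf (u + 1) p k * s ^ (u + 1))
      (p * s * (1 - p) ^ k * (1 / (1 - p * s) ^ (k + 1))) := by
    refine h.congr_fun fun u => ?_
    rw [nbPmf, show u + 1 + k - 1 = u + k by omega]; ring
  -- Restoring the term `u = 0`, the unit mass at 0, produces the correction at `k = 0`.
  have h3 := (hasSum_nat_add_iff (f := fun u => nbPmf u p k * s ^ u) 1).1 h2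
  rw [Finset.sum_range_one, nbPmf_zero] at h3
  have e : p * s / (1 - p * s) * ((1 - p) / (1 - p * s)) ^ k =
      p * s * (1 - p) ^ k * (1 / (1 - p * s) ^ (k + 1)) := by
    rw [div_pow]; field_simp; ring
  rw [e]
  simpa using h3

/-! ### The discretised mixing distribution -/

/-- The law of `⌈n Λ⌉` when `ν` is the law of `Λ`. -/
def ceilLaw (ν : Measure ℝ≥0) (n : ℕ) : Measure ℕ := ν.map fun l => ⌈(n : ℝ≥0) * l⌉₊

theorem measurable_ceil_mul (n : ℕ) : Measurable fun l : ℝ≥0 => ⌈(n : ℝ≥0) * l⌉₊ :=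
  Nat.measurable_ceil.comp (measurable_const_mul _)

instance isProbabilityMeasure_ceilLaw (ν : Measure ℝ≥0) [IsProbabilityMeasure ν] (n : ℕ) :
    IsProbabilityMeasure (ceilLaw ν n) :=
  Measure.isProbabilityMeasure_map (measurable_ceil_mul n).aemeasurable

theorem mixCdf_div (ν : Measure ℝ≥0) {n : ℕ} (hn : 1 ≤ n) (j : ℕ) :
    mixCdf ν ((j : ℝ) / n) = (ceilLaw ν n).real (Set.Iic j) := by
  have hn0 : (0 : ℝ) < n := by exact_mod_cast hn
  rw [mixCdf, measureReal_def, measureReal_def, ceilLaw,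
    Measure.map_apply (measurable_ceil_mul n) measurableSet_Iic]
  congr 2
  ext l
  simp only [Set.mem_ofPred_eq, Set.mem_preimage, Set.mem_Iic, Nat.ceil_le]
  rw [le_div_iff₀ hn0, mul_comm, ← NNReal.coe_le_coe]
  simp

theorem mixTail_div (ν : Measure ℝ≥0) [IsProbabilityMeasure ν] {n : ℕ} (hn : 1 ≤ n) (j : ℕ) :
    mixTail ν ((j : ℝ) / n) = (ceilLaw ν n).real (Set.Ioi j) := by
  rw [mixTail, mixCdf_div ν hn, ← probReal_compl_eq_one_sub measurableSet_Iic, Set.compl_Iic]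

/-- For natural `j`, `Λ ≤ j / n` iff `⌈nΛ⌉ ≤ j`. Hence the mixture is a negative binomial law with
random index `⌈nΛ⌉`. -/
theorem mixWeight_eq (ν : Measure ℝ≥0) [IsProbabilityMeasure ν] {n : ℕ} (hn : 1 ≤ n) (k : ℕ) :
    mixWeight ν n k = (ceilLaw ν n).real {k} := by
  rw [mixWeight, mixCdf_div ν hn]
  rcases k with _ | k
  · have hneg : (((0 : ℕ) : ℝ) - 1) / n < 0 := by
      have hn0 : (0 : ℝ) < n := by exact_mod_cast hn
      exact div_neg_of_neg_of_pos (by norm_num) hn0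
    have h : {l : ℝ≥0 | (l : ℝ) ≤ (((0 : ℕ) : ℝ) - 1) / n} = ∅ := by
      ext l
      simpa using hneg.trans_le l.2
    rw [mixCdf, h, measureReal_empty, sub_zero]
    congr 1; ext y; simp
  · rw [show (((k + 1 : ℕ) : ℝ) - 1) = k by push_cast; ring, mixCdf_div ν hn,
      ← measureReal_sdiff (Set.Iic_subset_Iic.2 (Nat.le_succ k)) measurableSet_Iic]
    congr 1; ext y; simp; omega

theorem approxClaimLaw_real_singleton (ν : Measure ℝ≥0) [IsProbabilityMeasure ν] {n : ℕ}
    (hn : 1 ≤ n) (x : ℕ) : (approxClaimLaw ν n).real {x} =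
      ∑' k, (ceilLaw ν n).real {k} * nbPmf k ((n : ℝ) / (n + 1)) x := by
  have hn0 : (0 : ℝ) < n := by exact_mod_cast hn
  simp_rw [approxClaimLaw, nbMixture, mixWeight_eq ν hn]
  rw [measureReal_def, Measure.sum_smul_dirac_singleton, ENNReal.toReal_ofReal]
  exact tsum_nonneg fun k => mul_nonneg measureReal_nonneg
    (nbPmf_nonneg k (by positivity) (by rw [div_le_one (by positivity)]; linarith) x)

theorem approxClaimLaw_singleton (ν : Measure ℝ≥0) [IsProbabilityMeasure ν] {n : ℕ}
    (hn : 1 ≤ n) (x : ℕ) : approxClaimLaw ν n {x} =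
      ∑' k, ceilLaw ν n {k} * ENNReal.ofReal (nbPmf k ((n : ℝ) / (n + 1)) x) := by
  have hn0 : (0 : ℝ) < n := by exact_mod_cast hn
  have hp : (0 : ℝ) < n / (n + 1) := by positivity
  have hp1 : (n : ℝ) / (n + 1) ≤ 1 := by rw [div_le_one (by positivity)]; linarith
  have := isProbabilityMeasure_approxClaimLaw ν n hn
  rw [← ofReal_measureReal, approxClaimLaw_real_singleton ν hn, ENNReal.ofReal_tsum_of_nonneg
    fun k => mul_nonneg measureReal_nonneg (nbPmf_nonneg k hp hp1 x)]
  · refine tsum_congr fun k => ?_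
    rw [ENNReal.ofReal_mul measureReal_nonneg, ofReal_measureReal]
  · exact Summable.of_nonneg_of_le
      (fun k => mul_nonneg measureReal_nonneg (nbPmf_nonneg k hp hp1 x))
      (fun k => mul_le_of_le_one_right measureReal_nonneg (nbPmf_le_one k hp hp1 x))
      (hasSum_measureReal_singleton (ceilLaw ν n)).summable

/-! ### Means -/

theorem claimMean_eq_tsum_mul (μ : Measure ℕ) : claimMean μ = ∑' x : ℕ, (x : ℝ≥0∞) * μ {x} :=
  lintegral_countable' _

/-- The factor `x + 1` is absorbed by the binomial coefficient, leaving `k * (1 - p) / p` times the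
probability function of index `k + 1`. -/
theorem tsum_mul_nbPmf (k : ℕ) {p : ℝ} (hp : 0 < p) (hp1 : p ≤ 1) :
    ∑' x : ℕ, (x : ℝ≥0∞) * ENNReal.ofReal (nbPmf k p x) = ENNReal.ofReal (k * ((1 - p) / p)) := by
  have hc : 0 ≤ k * ((1 - p) / p) := mul_nonneg k.cast_nonneg (div_nonneg (by linarith) hp.le)
  have hstep : ∀ x : ℕ, ((x + 1 : ℕ) : ℝ≥0∞) * ENNReal.ofReal (nbPmf k p (x + 1)) =
      ENNReal.ofReal (k * ((1 - p) / p)) * ENNReal.ofReal (nbPmf (k + 1) p x) := by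
    intro x
    rw [← ENNReal.ofReal_natCast, ← ENNReal.ofReal_mul (Nat.cast_nonneg _), ← ENNReal.ofReal_mul hc]
    congr 1
    have hchoose : ((x + 1 : ℕ) : ℝ) * ((k + x).choose (x + 1) : ℝ) = (k + x).choose x * k := by
      have := Nat.choose_succ_right_eq (k + x) x
      rw [Nat.add_sub_cancel] at this
      rw [mul_comm]; exact_mod_cast this
    simp only [nbPmf]
    rw [show k + (x + 1) - 1 = k + x by omega, show k + 1 + x - 1 = k + x by omega]
    calc _ = (((x + 1 : ℕ) : ℝ) * ((k + x).choose (x + 1) : ℝ)) * p ^ k * (1 - p) ^ (x + 1) := by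
          ring
      _ = _ := by rw [hchoose]; field_simp; ring
  rw [tsum_eq_zero_add' ENNReal.summable]
  simp_rw [hstep]
  rw [ENNReal.tsum_mul_left, ← ENNReal.ofReal_tsum_of_nonneg (nbPmf_nonneg (k + 1) hp hp1)
    (hasSum_nbPmf (k + 1) hp hp1).summable, (hasSum_nbPmf (k + 1) hp hp1).tsum_eq]
  simp

/-- For `p = n / (n + 1)` the ratio `(1 - p) / p` is `1 / n`, so index `k` contributes mean `k / n`.
-/
theorem claimMean_approxClaimLaw (ν : Measure ℝ≥0) [IsProbabilityMeasure ν] {n : ℕ}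
    (hn : 1 ≤ n) : claimMean (approxClaimLaw ν n) = claimMean (ceilLaw ν n) / n := by
  have hn0 : (0 : ℝ) < n := by exact_mod_cast hn
  have hp : (0 : ℝ) < n / (n + 1) := by positivity
  have hp1 : (n : ℝ) / (n + 1) ≤ 1 := by rw [div_le_one (by positivity)]; linarith
  have hq : (1 - (n : ℝ) / (n + 1)) / (n / (n + 1)) = (n : ℝ)⁻¹ := by field_simp; ring
  rw [claimMean_eq_tsum_mul, claimMean_eq_tsum_mul]
  simp_rw [approxClaimLaw_singleton ν hn, ← ENNReal.tsum_mul_left]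
  rw [ENNReal.tsum_comm, ENNReal.div_eq_inv_mul, mul_comm, ← ENNReal.tsum_mul_right]
  refine tsum_congr fun k => ?_
  simp_rw [mul_left_comm _ (ceilLaw ν n {k}), ENNReal.tsum_mul_left]
  rw [tsum_mul_nbPmf k hp hp1, hq, ENNReal.ofReal_mul (Nat.cast_nonneg _),
    ENNReal.ofReal_inv_of_pos hn0, ENNReal.ofReal_natCast, ENNReal.ofReal_natCast]
  ring

theorem claimMean_poissonMeasure (l : ℝ≥0) : claimMean (poissonMeasure l) = l := by
  rw [claimMean_eq_tsum_mul, tsum_eq_zero_add' ENNReal.summable]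
  have hstep : ∀ x : ℕ, ((x + 1 : ℕ) : ℝ≥0∞) * poissonMeasure l {x + 1} =
      l * poissonMeasure l {x} := by
    intro x
    rw [poissonMeasure_singleton, poissonMeasure_singleton, ← ENNReal.ofReal_natCast,
      ← ENNReal.ofReal_mul (Nat.cast_nonneg _), ← ENNReal.ofReal_coe_nnreal,
      ← ENNReal.ofReal_mul l.coe_nonneg]
    congr 1
    rw [Nat.factorial_succ, pow_succ]; push_cast; field_simp
  simp_rw [hstep]
  rw [ENNReal.tsum_mul_left]
  have : ∑' x : ℕ, poissonMeasure l {x} = 1 := by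
    rw [← measure_univ (μ := poissonMeasure l),
      ← Measure.tsum_indicator_apply_singleton (poissonMeasure l) _ MeasurableSet.univ]
    simp
  simp [this]

theorem claimMean_mixedPoisson (ν : Measure ℝ≥0) :
    claimMean (mixedPoisson ν) = ∫⁻ l, (l : ℝ≥0∞) ∂ν := by
  rw [claimMean, mixedPoisson, Measure.lintegral_bind measurable_poissonMeasure.aemeasurable
    (measurable_of_countable _).aemeasurable]
  exact lintegral_congr claimMean_poissonMeasure

theorem claimMean_ceilLaw (ν : Measure ℝ≥0) (n : ℕ) :
    claimMean (ceilLaw ν n) = ∫⁻ l, (⌈(n : ℝ≥0) * l⌉₊ : ℝ≥0∞) ∂ν :=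
  lintegral_map (measurable_of_countable _) (measurable_ceil_mul n)

theorem mul_claimMean_le_claimMean_ceilLaw (ν : Measure ℝ≥0) (n : ℕ) :
    n * claimMean (mixedPoisson ν) ≤ claimMean (ceilLaw ν n) := by
  rw [claimMean_ceilLaw, claimMean_mixedPoisson,
    ← lintegral_const_mul _ measurable_coe_nnreal_ennreal]
  exact lintegral_mono fun l => by simpa using ENNReal.coe_le_coe.2 (Nat.le_ceil ((n : ℝ≥0) * l))

theorem claimMean_ceilLaw_le (ν : Measure ℝ≥0) [IsProbabilityMeasure ν] (n : ℕ) :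
    claimMean (ceilLaw ν n) ≤ n * claimMean (mixedPoisson ν) + 1 := by
  rw [claimMean_ceilLaw, claimMean_mixedPoisson,
    ← lintegral_const_mul _ measurable_coe_nnreal_ennreal]
  have : (1 : ℝ≥0∞) = ∫⁻ _, 1 ∂ν := by simp
  rw [this, ← lintegral_add_right _ measurable_const]
  exact lintegral_mono fun l => by
    simpa using ENNReal.coe_le_coe.2 (Nat.ceil_lt_add_one (a := (n : ℝ≥0) * l) zero_le).le

theorem claimMean_ceilLaw_lt_top {ν : Measure ℝ≥0} [IsProbabilityMeasure ν]
    (h : claimMean (mixedPoisson ν) < ⊤) (n : ℕ) : claimMean (ceilLaw ν n) < ⊤ :=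
  (claimMean_ceilLaw_le ν n).trans_lt (ENNReal.add_lt_top.2
    ⟨ENNReal.mul_lt_top (ENNReal.natCast_lt_top n) h, ENNReal.one_lt_top⟩)

theorem tendsto_claimMean_approxClaimLaw (ν : Measure ℝ≥0) [IsProbabilityMeasure ν] :
    Tendsto (fun n => claimMean (approxClaimLaw ν n)) atTop (𝓝 (claimMean (mixedPoisson ν))) := by
  have hinv : Tendsto (fun n : ℕ => claimMean (mixedPoisson ν) + (n : ℝ≥0∞)⁻¹) atTop
      (𝓝 (claimMean (mixedPoisson ν))) := by
    simpa using tendsto_const_nhds.add ENNReal.tendsto_inv_nat_nhds_zero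
  refine tendsto_of_tendsto_of_tendsto_of_le_of_le' tendsto_const_nhds hinv ?_ ?_
  · filter_upwards [eventually_ge_atTop 1] with n hn
    have hn0 : (n : ℝ≥0∞) ≠ 0 := by simp; omega
    rw [claimMean_approxClaimLaw ν hn, ENNReal.le_div_iff_mul_le (.inl hn0) (.inl (by simp)),
      mul_comm]
    exact mul_claimMean_le_claimMean_ceilLaw ν n
  · filter_upwards [eventually_ge_atTop 1] with n hn
    have hn0 : (n : ℝ≥0∞) ≠ 0 := by simp; omega
    rw [claimMean_approxClaimLaw ν hn, ENNReal.div_le_iff hn0 (by simp), add_mul,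
      ENNReal.inv_mul_cancel hn0 (by simp), mul_comm]
    exact claimMean_ceilLaw_le ν n

/-! ### Convergence of the claim distributions -/

/-- This form shows the Poisson limit when `k / n → l`: each of the `x` factors tends to `l` and the
last power to `exp (-l)`. -/
theorem nbPmf_eq_prod (k n x : ℕ) : nbPmf k ((n : ℝ) / (n + 1)) x =
    (∏ i ∈ Finset.range x, ((k : ℝ) + i) / (n + 1)) / x.factorial * ((n : ℝ) / (n + 1)) ^ k := by
  have h := Nat.ascFactorial_eq_factorial_mul_choose' k x
  rw [Nat.ascFactorial_eq_prod_range] at h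
  have h' : ∏ i ∈ Finset.range x, ((k : ℝ) + i) = x.factorial * ((k + x - 1).choose x : ℝ) := by
    exact_mod_cast h
  have hf : (x.factorial : ℝ) ≠ 0 := by positivity
  have hq : 1 - (n : ℝ) / (n + 1) = 1 / (n + 1) := by field_simp; ring
  rw [nbPmf, Finset.prod_div_distrib, h', hq]
  simp only [Finset.prod_const, Finset.card_range, one_div, inv_pow]
  field_simp

theorem tendsto_nbPmf_ceil (l : ℝ≥0) (x : ℕ) :
    Tendsto (fun n : ℕ => nbPmf ⌈(n : ℝ≥0) * l⌉₊ ((n : ℝ) / (n + 1)) x) atTop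
      (𝓝 (Real.exp (-l) * l ^ x / x.factorial)) := by
  simp_rw [nbPmf_eq_prod]
  have hk : Tendsto (fun n : ℕ => (⌈(n : ℝ≥0) * l⌉₊ : ℝ) / n) atTop (𝓝 (l : ℝ)) := by
    have h := (tendsto_nat_ceil_mul_div_atTop (R := ℝ) l.coe_nonneg).comp
      tendsto_natCast_atTop_atTop
    refine h.congr fun n => ?_
    have : ⌈(l : ℝ) * n⌉₊ = ⌈(n : ℝ≥0) * l⌉₊ := by
      refine eq_of_forall_ge_iff fun c => ?_
      rw [Nat.ceil_le, Nat.ceil_le, ← NNReal.coe_le_coe]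
      simp [mul_comm]
    simp [this]
  have hn1 : Tendsto (fun n : ℕ => (n : ℝ) / (n + 1)) atTop (𝓝 1) :=
    tendsto_natCast_div_add_atTop 1
  have hfac : ∀ i : ℕ, Tendsto (fun n : ℕ => ((⌈(n : ℝ≥0) * l⌉₊ : ℝ) + i) / (n + 1)) atTop
      (𝓝 (l : ℝ)) := by
    intro i
    have h := (hk.add (tendsto_const_div_atTop_nhds_zero_nat (i : ℝ))).mul hn1
    rw [add_zero, mul_one] at h
    refine h.congr' ?_
    filter_upwards [eventually_ge_atTop 1] with n hn
    have hn0 : (n : ℝ) ≠ 0 := by positivity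
    field_simp
  have hlog : Tendsto (fun n : ℕ => (n : ℝ) * Real.log (1 + 1 / n)) atTop (𝓝 1) :=
    (Real.tendsto_mul_log_one_add_div_atTop 1).comp tendsto_natCast_atTop_atTop
  have hexp : Tendsto (fun n : ℕ => ((n : ℝ) / (n + 1)) ^ ⌈(n : ℝ≥0) * l⌉₊) atTop
      (𝓝 (Real.exp (-l))) := by
    have h := (Real.continuous_exp.tendsto _).comp (hk.mul hlog).neg
    rw [mul_one] at h
    refine h.congr' ?_
    filter_upwards [eventually_ge_atTop 1] with n hn
    have hn0 : (0 : ℝ) < n := by positivity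
    have e : (n : ℝ) / (n + 1) = Real.exp (-Real.log (1 + 1 / n)) := by
      rw [Real.exp_neg, Real.exp_log (by positivity)]; field_simp
    rw [e, ← Real.exp_nat_mul]
    simp only [Function.comp_apply]
    congr 1
    field_simp
  have h := ((tendsto_finsetProd (Finset.range x) fun i _ => hfac i).div_const
    (x.factorial : ℝ)).mul hexp
  simp only [Finset.prod_const, Finset.card_range] at h
  convert h using 2
  ring

theorem mixedPoisson_real_singleton (ν : Measure ℝ≥0) (x : ℕ) :
    (mixedPoisson ν).real {x} = ∫ l : ℝ≥0, Real.exp (-l) * l ^ x / x.factorial ∂ν := by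
  rw [integral_eq_lintegral_of_nonneg_ae (Eventually.of_forall fun l => by positivity)
    (by fun_prop), measureReal_def, mixedPoisson_singleton]
  simp_rw [poissonMeasure_singleton]

theorem approxClaimLaw_real_singleton_eq_integral (ν : Measure ℝ≥0) [IsProbabilityMeasure ν]
    {n : ℕ} (hn : 1 ≤ n) (x : ℕ) : (approxClaimLaw ν n).real {x} =
      ∫ l : ℝ≥0, nbPmf ⌈(n : ℝ≥0) * l⌉₊ ((n : ℝ) / (n + 1)) x ∂ν := by
  have hn0 : (0 : ℝ) < n := by exact_mod_cast hn
  have hp : (0 : ℝ) < n / (n + 1) := by positivity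
  have hp1 : (n : ℝ) / (n + 1) ≤ 1 := by rw [div_le_one (by positivity)]; linarith
  have hint : Integrable (fun k => nbPmf k ((n : ℝ) / (n + 1)) x) (ceilLaw ν n) :=
    Integrable.of_bound (measurable_of_countable _).aestronglyMeasurable 1
      (Eventually.of_forall fun k => by
        rw [Real.norm_of_nonneg (nbPmf_nonneg k hp hp1 x)]; exact nbPmf_le_one k hp hp1 x)
  have h := integral_countable hint
  rw [ceilLaw, integral_map (measurable_ceil_mul n).aemeasurable
    (measurable_of_countable _).aestronglyMeasurable] at h
  rw [h, approxClaimLaw_real_singleton ν hn]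
  rfl

theorem tendsto_approxClaimLaw_real_singleton (ν : Measure ℝ≥0) [IsProbabilityMeasure ν] (x : ℕ) :
    Tendsto (fun n => (approxClaimLaw ν n).real {x}) atTop (𝓝 ((mixedPoisson ν).real {x})) := by
  rw [mixedPoisson_real_singleton]
  -- The index is shifted so that the success probability is positive and the bound 1 holds for
  -- every `n`.
  have h : Tendsto (fun n : ℕ => ∫ l : ℝ≥0, nbPmf ⌈((n + 1 : ℕ) : ℝ≥0) * l⌉₊
      (((n + 1 : ℕ) : ℝ) / ((n + 1 : ℕ) + 1)) x ∂ν) atTop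
      (𝓝 (∫ l : ℝ≥0, Real.exp (-l) * l ^ x / x.factorial ∂ν)) := by
    refine tendsto_integral_of_dominated_convergence (fun _ => 1) (fun n => ?_)
      (integrable_const 1) (fun n => Eventually.of_forall fun l => ?_)
      (Eventually.of_forall fun l => (tendsto_nbPmf_ceil l x).comp (tendsto_add_atTop_nat 1))
    · exact ((measurable_of_countable fun k : ℕ => nbPmf k
        (((n + 1 : ℕ) : ℝ) / ((n + 1 : ℕ) + 1)) x).comp
          (measurable_ceil_mul (n + 1))).aestronglyMeasurable
    · have hp1 : ((n + 1 : ℕ) : ℝ) / ((n + 1 : ℕ) + 1) ≤ 1 := by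
        rw [div_le_one (by positivity)]; linarith
      rw [Real.norm_of_nonneg (nbPmf_nonneg _ (by positivity) hp1 x)]
      exact nbPmf_le_one _ (by positivity) hp1 x
  refine (tendsto_add_atTop_iff_nat 1).1 (h.congr fun n => ?_)
  rw [approxClaimLaw_real_singleton_eq_integral ν (by omega)]

/-! ### The coefficients and their generating function -/

section Coefficients

variable {ν : Measure ℝ≥0} [IsProbabilityMeasure ν] {n : ℕ} {m : ℝ}

theorem mixTail_sub_one_div (hn : 1 ≤ n) (i : ℕ) :
    mixTail ν ((((i + 1 : ℕ) : ℝ) - 1) / n) = (ceilLaw ν n).real (Set.Ioi i) := by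
  rw [← mixTail_div ν hn]; push_cast; rw [add_sub_cancel_right]

theorem coeffZero_eq (hn : 1 ≤ n) (h : HasSum (fun j => (ceilLaw ν n).real (Set.Ioi j)) m) :
    coeffZero ν n = m / n := by
  simp_rw [coeffZero, mixTail_div ν hn]
  exact (h.div_const _).tsum_eq

theorem coeffZero_mul_fNe (hn : 1 ≤ n)
    (h : HasSum (fun j => (ceilLaw ν n).real (Set.Ioi j)) m) (i : ℕ) :
    coeffZero ν n * fNe ν n (i + 1) = (ceilLaw ν n).real (Set.Ioi i) / n := by
  rw [coeffZero_eq hn h, fNe, mixTail_sub_one_div hn]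
  simp_rw [mixTail_div ν hn, h.tsum_eq]
  -- For `m = 0` the quotient in `fNe` is a division by zero with value 0; the tails vanish too.
  rcases eq_or_ne m 0 with rfl | hm
  · have h0 := congrFun ((hasSum_zero_iff_of_nonneg fun j => measureReal_nonneg).1 h) i
    simp only [Pi.zero_apply] at h0
    simp [h0]
  · field_simp

/-- Passing to complements absorbs `tailNe`, leaving a renewal equation with constant forcing term.
-/
theorem one_sub_coeff_succ (hn : 1 ≤ n)
    (h : HasSum (fun j => (ceilLaw ν n).real (Set.Ioi j)) m) (k : ℕ) :
    1 - coeff ν n (k + 1) = (1 - coeffZero ν n) + ∑ i ∈ Finset.range (k + 1),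
      (ceilLaw ν n).real (Set.Ioi i) / n * (1 - coeff ν n (k - i)) := by
  rw [coeff, Fin.sum_univ_eq_sum_range (fun i => fNe ν n (i + 1) * coeff ν n (k - i)) (k + 1),
    tailNe, ← Finset.Ico_add_one_right_eq_Icc, Finset.sum_Ico_eq_sum_range]
  simp_rw [← coeffZero_mul_fNe hn h, mul_sub, mul_one, Finset.sum_sub_distrib, mul_assoc,
    ← Finset.mul_sum, Nat.add_sub_cancel, add_comm 1, mul_add, mul_sub]
  ring

/-- The renewal kernel is non-negative with total mass `coeffZero ν n ≤ 1`, so the bounds propagate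
by induction. They supply the convergence of the later series. -/
theorem one_sub_coeff_mem_Icc (hn : 1 ≤ n)
    (h : HasSum (fun j => (ceilLaw ν n).real (Set.Ioi j)) m) (h1 : coeffZero ν n ≤ 1) (k : ℕ) :
    1 - coeff ν n k ∈ Set.Icc (0 : ℝ) 1 := by
  have hpart : ∀ k, ∑ i ∈ Finset.range k, (ceilLaw ν n).real (Set.Ioi i) / n ≤ coeffZero ν n := by
    intro k
    rw [coeffZero_eq hn h]
    exact sum_le_hasSum _ (fun i _ => div_nonneg measureReal_nonneg n.cast_nonneg) (h.div_const _)
  induction k using Nat.strong_induction_on with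
  | _ k ih =>
    rcases k with _ | k
    · have := hpart 0
      rw [coeff_zero]
      simp only [Finset.range_zero, Finset.sum_empty] at this
      constructor <;> linarith
    · have hnn : ∀ i, 0 ≤ (ceilLaw ν n).real (Set.Ioi i) / n := fun i =>
        div_nonneg measureReal_nonneg n.cast_nonneg
      have hlow : 0 ≤ ∑ i ∈ Finset.range (k + 1),
          (ceilLaw ν n).real (Set.Ioi i) / n * (1 - coeff ν n (k - i)) :=
        Finset.sum_nonneg fun i _ => mul_nonneg (hnn i) (ih _ (by omega)).1
      have hup : ∑ i ∈ Finset.range (k + 1),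
          (ceilLaw ν n).real (Set.Ioi i) / n * (1 - coeff ν n (k - i)) ≤
          ∑ i ∈ Finset.range (k + 1), (ceilLaw ν n).real (Set.Ioi i) / n :=
        Finset.sum_le_sum fun i _ => mul_le_of_le_one_right (hnn i) (ih _ (by omega)).2
      have := hpart (k + 1)
      rw [one_sub_coeff_succ hn h]
      constructor <;> linarith

end Coefficients

/-- The generating function of the distribution function of a compound geometric law. -/
theorem tsum_mul_pow_of_renewal {D T : ℕ → ℝ} {c N r : ℝ} (hD0 : D 0 = 1 - c)
    (hD : ∀ k, D (k + 1) = (1 - c) + ∑ i ∈ Finset.range (k + 1), T i / N * D (k - i))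
    (hDb : ∀ k, ‖D k‖ ≤ 1) (hTb : ∀ k, ‖T k‖ ≤ 1) (hr : 0 ≤ r) (hr1 : r < 1) :
    (∑' k, D k * r ^ k) * (1 - r / N * ∑' k, T k * r ^ k) = (1 - c) / (1 - r) := by
  have hsD := (summable_mul_pow_of_bounded hDb hr hr1).of_norm
  have hgeo := (hasSum_geometric_of_lt_one hr hr1).mul_left ((1 - c) * r)
  have hconv : Summable fun k => (∑ i ∈ Finset.range (k + 1), T i * D (k - i)) * r ^ k := by
    have := summable_norm_sum_mul_range_of_summable_norm
      (summable_mul_pow_of_bounded hTb hr hr1) (summable_mul_pow_of_bounded hDb hr hr1)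
    refine this.of_norm.congr fun k => ?_
    rw [Finset.sum_mul]
    refine Finset.sum_congr rfl fun i hi => ?_
    have : k = i + (k - i) := by have := Finset.mem_range.1 hi; omega
    conv_rhs => rw [this, pow_add, add_tsub_cancel_left]
    ring
  have h1 := hsD.tsum_eq_zero_add
  have h2 : ∑' k, D (k + 1) * r ^ (k + 1) = (1 - c) * r * (1 - r)⁻¹ +
      r / N * ∑' k, (∑ i ∈ Finset.range (k + 1), T i * D (k - i)) * r ^ k := by
    rw [← hgeo.tsum_eq, ← tsum_mul_left, ← hgeo.summable.tsum_add (hconv.mul_left _)]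
    refine tsum_congr fun k => ?_
    rw [hD, pow_succ, Finset.sum_mul, add_mul, Finset.sum_mul, Finset.mul_sum]
    congr 1
    · ring
    · exact Finset.sum_congr rfl fun i _ => by ring
  rw [h2, ← tsum_mul_tsum_mul_pow hTb hDb hr hr1, hD0, pow_zero, mul_one] at h1
  have hne : 1 - r ≠ 0 := by linarith
  have e : (1 - c) + (1 - c) * r * (1 - r)⁻¹ = (1 - c) / (1 - r) := by field_simp; ring
  linarith

/-- The generating function of the survival probability in the initial capital. -/
theorem tsum_mul_pow_of_recursion {φ f : ℕ → ℝ} {s : ℝ}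
    (hrec : ∀ u, φ u = ∑ y ∈ Finset.range (u + 1), f y * φ (u + 1 - y))
    (hφ : ∀ u, ‖φ u‖ ≤ 1) (hf : ∀ y, ‖f y‖ ≤ 1) (hs : 0 ≤ s) (hs1 : s < 1) :
    ((∑' y, f y * s ^ y) - s) * ∑' u, φ u * s ^ u = (∑' y, f y * s ^ y) * φ 0 := by
  have hsum := (summable_mul_pow_of_bounded hφ hs hs1).of_norm
  have h1 := hsum.tsum_eq_zero_add
  have h2 : ∑' u, φ (u + 1) * s ^ (u + 1) = s * ∑' u, φ (u + 1) * s ^ u := by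
    rw [← tsum_mul_left]; exact tsum_congr fun u => by ring
  -- Since `u + 1 - y = (u - y) + 1`, the recursion is a convolution of `f` with the shifted `φ`.
  have h3 := tsum_mul_tsum_mul_pow hf (fun u => hφ (u + 1)) hs hs1
  have h4 : ∑' u, φ u * s ^ u =
      ∑' u, (∑ y ∈ Finset.range (u + 1), f y * φ (u - y + 1)) * s ^ u := by
    refine tsum_congr fun u => ?_
    rw [hrec u]
    congr 1
    refine Finset.sum_congr rfl fun y hy => ?_
    rw [Nat.sub_add_comm (by have := Finset.mem_range.1 hy; omega)]
  rw [← h4] at h3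
  rw [h2, pow_zero, mul_one] at h1
  linear_combination (∑' y, f y * s ^ y) * h1 + s * h3

/-- The probability generating function of the approximating claim distribution. -/
theorem tsum_approxClaimLaw_mul_pow (ν : Measure ℝ≥0) [IsProbabilityMeasure ν] {n : ℕ}
    (hn : 1 ≤ n) {s : ℝ} (hs : 0 ≤ s) (hs1 : s < 1) :
    ∑' x, (approxClaimLaw ν n).real {x} * s ^ x =
      ∑' k, (ceilLaw ν n).real {k} * ((n : ℝ) / (n + 1 - s)) ^ k := by
  have hn0 : (0 : ℝ) < n := by exact_mod_cast hn
  have hp : (0 : ℝ) < n / (n + 1) := by positivity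
  have hp1 : (n : ℝ) / (n + 1) ≤ 1 := by rw [div_le_one (by positivity)]; linarith
  have hden : (0 : ℝ) < n + 1 - s := by linarith
  have hr : (n : ℝ) / (n + 1) / (1 - (1 - n / (n + 1)) * s) = n / (n + 1 - s) := by
    have : (1 - (1 - (n : ℝ) / (n + 1)) * s) = (n + 1 - s) / (n + 1) := by field_simp; ring
    rw [this]; field_simp
  have hb : ∀ k, HasSum (fun x => (ceilLaw ν n).real {k} * (nbPmf k ((n : ℝ) / (n + 1)) x * s ^ x))
      ((ceilLaw ν n).real {k} * ((n : ℝ) / (n + 1 - s)) ^ k) := fun k => by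
    rw [← hr]; exact (hasSum_nbPmf_mul_pow k hp hp1 hs hs1.le).mul_left _
  have hc : Summable fun k => (ceilLaw ν n).real {k} * ((n : ℝ) / (n + 1 - s)) ^ k :=
    (summable_mul_pow_of_bounded (C := 1) (fun k => by
      rw [Real.norm_of_nonneg measureReal_nonneg]; exact measureReal_le_one) (by positivity)
      (by rw [div_lt_one hden]; linarith)).of_norm
  have h := (hasSum_tsum_of_nonneg (fun k x => mul_nonneg measureReal_nonneg
    (mul_nonneg (nbPmf_nonneg k hp hp1 x) (pow_nonneg hs x))) hb hc.hasSum).2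
  rw [← h.tsum_eq]
  refine tsum_congr fun x => ?_
  rw [approxClaimLaw_real_singleton ν hn, ← tsum_mul_right]
  exact tsum_congr fun k => by ring

/-! ### Ruin probabilities for negative binomial mixtures -/

/-- The mixture `φ` of `D` and the true survival probability are bounded in `u`, so comparing
generating functions on `(0, 1)` is enough. The ruin series is then total mass 1 minus the series
for `φ`. -/
theorem IsClaimSequence.hasSum_ruinProb {ν : Measure ℝ≥0} [IsProbabilityMeasure ν] {n : ℕ}
    (hn : 1 ≤ n) {Ω : Type*} [MeasurableSpace Ω] {P : Measure Ω} {X : ℕ → Ω → ℕ}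
    (hX : IsClaimSequence P X (approxClaimLaw ν n)) (hmean : claimMean (approxClaimLaw ν n) < 1)
    (hfin : claimMean (ceilLaw ν n) < ⊤) (u : ℕ) :
    HasSum (fun k => coeff ν n k * nbPmf u (1 / (1 + n)) k) (ruinProb P X u) := by
  have hn0 : (0 : ℝ) < n := by exact_mod_cast hn
  have hp : (0 : ℝ) < 1 / (1 + n) := by positivity
  have hp1 : 1 / (1 + (n : ℝ)) ≤ 1 := by rw [div_le_one (by positivity)]; linarith
  have hm := hasSum_tail_of_claimMean_lt_top hfin
  have hC0 : (claimMean (approxClaimLaw ν n)).toReal = coeffZero ν n := by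
    rw [claimMean_approxClaimLaw ν hn, coeffZero_eq hn hm, ENNReal.toReal_div]; simp
  have hlt : coeffZero ν n < 1 := by
    rw [← hC0, ← ENNReal.toReal_one]
    exact (ENNReal.toReal_lt_toReal (hmean.trans ENNReal.one_lt_top).ne ENNReal.one_ne_top).2 hmean
  have hD := one_sub_coeff_mem_Icc hn hm hlt.le
  set D : ℕ → ℝ := fun k => 1 - coeff ν n k with hDdef
  have hDb : ∀ k, ‖D k‖ ≤ 1 := fun k => by rw [Real.norm_of_nonneg (hD k).1]; exact (hD k).2
  have hκb : ∀ s : ℕ → Set ℕ, ∀ k, ‖(ceilLaw ν n).real (s k)‖ ≤ 1 := fun s k => by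
    rw [Real.norm_of_nonneg measureReal_nonneg]; exact measureReal_le_one
  have hlaw := hX.isProbabilityMeasure_law
  have hfb : ∀ k, ‖(approxClaimLaw ν n).real {k}‖ ≤ 1 := fun k => by
    rw [Real.norm_of_nonneg measureReal_nonneg]; exact measureReal_le_one
  have hφb : ∀ u, ‖survivalProb P X u‖ ≤ 1 := fun u => by
    rw [Real.norm_of_nonneg (survivalProb_nonneg u)]; exact hX.survivalProb_le_one u
  have hnn : ∀ u k, 0 ≤ D k * nbPmf u (1 / (1 + n)) k := fun u k =>
    mul_nonneg (hD k).1 (nbPmf_nonneg u hp hp1 k)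
  have hle : ∀ u k, D k * nbPmf u (1 / (1 + n)) k ≤ nbPmf u (1 / (1 + n)) k := fun u k =>
    mul_le_of_le_one_left (nbPmf_nonneg u hp hp1 k) (hD k).2
  have hsum : ∀ u, Summable fun k => D k * nbPmf u (1 / (1 + n)) k := fun u =>
    Summable.of_nonneg_of_le (hnn u) (hle u) (hasSum_nbPmf u hp hp1).summable
  set φ : ℕ → ℝ := fun u => ∑' k, D k * nbPmf u (1 / (1 + n)) k with hφdef
  have hφb' : ∀ u, ‖φ u‖ ≤ 1 := fun u => by
    rw [Real.norm_of_nonneg (tsum_nonneg (hnn u))]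
    exact hasSum_le (hle u) (hsum u).hasSum (hasSum_nbPmf u hp hp1)
  have hgf : ∀ s : ℝ, 0 < s → s < 1 → ∑' u, φ u * s ^ u = ∑' u, survivalProb P X u * s ^ u := by
    intro s hs hs1
    have hden : (0 : ℝ) < n + 1 - s := by linarith
    set r : ℝ := n / (n + 1 - s) with hr
    have hr0 : 0 ≤ r := by positivity
    have hr1 : r < 1 := by rw [hr, div_lt_one hden]; linarith
    have hps : 1 / (1 + (n : ℝ)) * s / (1 - 1 / (1 + n) * s) = s / (n + 1 - s) := by
      have : 1 - 1 / (1 + (n : ℝ)) * s = (n + 1 - s) / (1 + n) := by field_simp; ring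
      rw [this]; field_simp
    have hpr : (1 - 1 / (1 + (n : ℝ))) / (1 - 1 / (1 + n) * s) = r := by
      have h1 : 1 - 1 / (1 + (n : ℝ)) * s = (n + 1 - s) / (1 + n) := by field_simp; ring
      have h2 : 1 - 1 / (1 + (n : ℝ)) = n / (1 + n) := by field_simp; ring
      rw [h1, h2, hr]; field_simp
    have hsD := (summable_mul_pow_of_bounded hDb hr0 hr1).of_norm
    have hb : ∀ k, HasSum (fun u => D k * (nbPmf u (1 / (1 + n)) k * s ^ u))
        (D k * (s / (n + 1 - s) * r ^ k + if k = 0 then 1 else 0)) := fun k => by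
      rw [← hps, ← hpr]; exact (hasSum_nbPmf_mul_pow_left k hp hp1 hs.le hs1).mul_left _
    have hc : HasSum (fun k => D k * (s / (n + 1 - s) * r ^ k + if k = 0 then 1 else 0))
        (s / (n + 1 - s) * (∑' k, D k * r ^ k) + D 0) := by
      refine ((hsD.hasSum.mul_left (s / (n + 1 - s))).add (hasSum_ite_eq 0 (D 0))).congr_fun
        fun k => ?_
      rcases k with _ | k <;> simp <;> ring
    have hΦ : ∑' u, φ u * s ^ u = s / (n + 1 - s) * (∑' k, D k * r ^ k) + D 0 := by
      rw [← (hasSum_tsum_of_nonneg (fun k u => mul_nonneg (hD k).1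
        (mul_nonneg (nbPmf_nonneg u hp hp1 k) (pow_nonneg hs.le u))) hb hc).2.tsum_eq]
      refine tsum_congr fun u => ?_
      rw [hφdef, ← tsum_mul_right]
      exact tsum_congr fun k => by ring
    have hW := tsum_mul_pow_of_renewal (D := D) (c := coeffZero ν n)
      (by simp only [hDdef, coeff_zero]) (one_sub_coeff_succ hn hm) hDb (hκb Set.Ioi) hr0 hr1
    have hT := one_sub_mul_tsum_tail (ceilLaw ν n) hr0 hr1
    have htrue := tsum_mul_pow_of_recursion hX.survivalProb_eq_sum hφb hfb hs.le hs1
    rw [tsum_approxClaimLaw_mul_pow ν hn hs.le hs1, hX.survivalProb_zero hmean, hC0] at htrue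
    have hD0 : D 0 = 1 - coeffZero ν n := by simp only [hDdef, coeff_zero]
    rw [hΦ, hD0]
    set W := ∑' k, D k * r ^ k
    set Q := ∑' k, (ceilLaw ν n).real {k} * r ^ k
    set T := ∑' k, (ceilLaw ν n).real (Set.Ioi k) * r ^ k
    set Φ := ∑' u, survivalProb P X u * s ^ u
    -- The renewal denominator is `(1 - r) - (1 - Q) / (n + 1 - s) = (Q - s) / (n + 1 - s)`: the
    -- factor `Q - s` of the ruin recursion reappears.
    have hWQ : (Q - s) * W = (1 - coeffZero ν n) * (n + 1 - s) := by
      have h1r : 1 - r = (1 - s) / (n + 1 - s) := by rw [hr]; field_simp; ring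
      have hrn : r / n = 1 / (n + 1 - s) := by rw [hr]; field_simp
      rw [eq_div_iff (by linarith), hrn] at hW
      have h2 : W * ((1 - r) - 1 / (n + 1 - s) * (1 - Q)) = 1 - coeffZero ν n := by
        rw [← hT, ← hW]; ring
      rw [h1r] at h2
      rw [← h2]; field_simp; ring
    -- The right side of `hWQ` is non-zero, by net profit and `s < 1`.
    have hQs : Q - s ≠ 0 := by
      intro h0
      rw [h0, zero_mul] at hWQ
      rcases mul_eq_zero.1 hWQ.symm with h | h <;> linarith
    refine mul_left_cancel₀ hQs ?_
    rw [htrue, mul_add, mul_left_comm, hWQ]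
    field_simp
    ring
  have heq : φ u = survivalProb P X u := by
    refine sub_eq_zero.1 (eq_zero_of_tsum_mul_pow_eq_zero (d := fun u => φ u - survivalProb P X u)
      (C := 1 + 1) (fun k => (norm_sub_le _ _).trans (add_le_add (hφb' k) (hφb k)))
      (fun s hs hs1 => ?_) u)
    simp_rw [sub_mul]
    rw [Summable.tsum_sub (summable_mul_pow_of_bounded hφb' hs.le hs1).of_norm
      (summable_mul_pow_of_bounded hφb hs.le hs1).of_norm, hgf s hs hs1, sub_self]
  rw [hX.ruinProb_eq, ← heq]
  refine ((hasSum_nbPmf u hp hp1).sub (hsum u).hasSum).congr_fun fun k => ?_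
  simp only [hDdef]; ring

theorem tendsto_ruinProb (ν : Measure ℝ≥0) [IsProbabilityMeasure ν]
    {Ω : Type*} [MeasurableSpace Ω] {P : Measure Ω} {Y : ℕ → Ω → ℕ}
    (hY : IsClaimSequence P Y (mixedPoisson ν)) (hnet : claimMean (mixedPoisson ν) < 1)
    {Ω' : ℕ → Type*} [∀ n, MeasurableSpace (Ω' n)] {P' : ∀ n, Measure (Ω' n)}
    {X : ∀ n, ℕ → Ω' n → ℕ}
    (hX : ∀ n, 1 ≤ n → IsClaimSequence (P' n) (X n) (approxClaimLaw ν n)) (u : ℕ) :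
    Tendsto (fun n => ruinProb (P' n) (X n) u) atTop (𝓝 (ruinProb P Y u)) := by
  have hmean := tendsto_claimMean_approxClaimLaw ν
  have hlim : Tendsto (fun n => survivalProb (P' n) (X n) u) atTop (𝓝 (survivalProb P Y u)) := by
    refine tendsto_of_recursion (φ := fun n => survivalProb (P' n) (X n))
      ((eventually_ge_atTop 1).mono fun n hn => (hX n hn).survivalProb_eq_sum)
      hY.survivalProb_eq_sum (tendsto_approxClaimLaw_real_singleton ν)
      (hY.law_zero_ne_zero hnet) ?_ u
    rw [hY.survivalProb_zero hnet]
    have h := ((ENNReal.tendsto_toReal (hnet.trans ENNReal.one_lt_top).ne).comp hmean).const_sub 1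
    refine h.congr' ?_
    filter_upwards [eventually_ge_atTop 1, hmean.eventually (gt_mem_nhds hnet)] with n hn h1
    exact ((hX n hn).survivalProb_zero h1).symm
  rw [hY.ruinProb_eq]
  refine (hlim.const_sub 1).congr' ?_
  filter_upwards [eventually_ge_atTop 1] with n hn
  exact ((hX n hn).ruinProb_eq u).symm

end


/-! ### The limit and the series combined -/

theorem mainTheorem2 (ν : Measure ℝ≥0) [IsProbabilityMeasure ν]
    {Ω : Type*} [MeasurableSpace Ω] (P : Measure Ω) (Y : ℕ → Ω → ℕ)
    (hY : IsClaimSequence P Y (mixedPoisson ν))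
    (hpos : claimMean (mixedPoisson ν) ≠ 0) (hnet : claimMean (mixedPoisson ν) < 1)
    {Ω' : ℕ → Type*} [∀ n, MeasurableSpace (Ω' n)] (P' : ∀ n, Measure (Ω' n))
    (X : ∀ n, ℕ → Ω' n → ℕ)
    (hX : ∀ n, 1 ≤ n → IsClaimSequence (P' n) (X n) (approxClaimLaw ν n)) :
    (∀ u : ℕ, Tendsto (fun n => ruinProb (P' n) (X n) u) atTop (𝓝 (ruinProb P Y u))) ∧
    (∀ n : ℕ, 1 ≤ n → Summable fun j : ℕ => mixTail ν ((j : ℝ) / n)) ∧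
    (∀ᶠ n : ℕ in atTop, claimMean (approxClaimLaw ν n) < 1) ∧
    (∀ n : ℕ, 1 ≤ n → claimMean (approxClaimLaw ν n) < 1 → ∀ u : ℕ,
      HasSum (fun k => coeff ν n k * nbPmf u (1 / (1 + n)) k) (ruinProb (P' n) (X n) u)) ∧
    (∀ u : ℕ, Tendsto (fun n : ℕ => ∑' k, coeff ν n k * nbPmf u (1 / (1 + n)) k) atTop
      (𝓝 (ruinProb P Y u))) := by
  have hlim := tendsto_ruinProb ν hY hnet hX
  have hfin := claimMean_ceilLaw_lt_top (hnet.trans ENNReal.one_lt_top)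
  have hmean := (tendsto_claimMean_approxClaimLaw ν).eventually (gt_mem_nhds hnet)
  have hseries : ∀ n : ℕ, 1 ≤ n → claimMean (approxClaimLaw ν n) < 1 → ∀ u : ℕ,
      HasSum (fun k => coeff ν n k * nbPmf u (1 / (1 + n)) k) (ruinProb (P' n) (X n) u) :=
    fun n hn h u => (hX n hn).hasSum_ruinProb hn h (hfin n) u
  refine ⟨hlim, fun n hn => ?_, hmean, hseries, fun u => (hlim u).congr' ?_⟩
  · simp_rw [mixTail_div ν hn]
    exact (hasSum_tail_of_claimMean_lt_top (hfin n)).summable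
  · filter_upwards [eventually_ge_atTop 1, hmean] with n hn h
    exact (hseries n hn h u).tsum_eq.symm
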